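/- Let \(S=(A,B,C,D)\) be a discrete-time linear time-invariant system \(x_{k+1}=Ax_k+Bu_k\), \(y_k=Cx_k+Du_k\) with real matrices \(A\in\mathbb{R}^{n_x\times n_x}\), \(B\in\mathbb{R}^{n_x\times n_u}\), \(C\in\mathbb{R}^{n_y\times n_x}\), \(D\in\mathbb{R}^{n_y\times n_u}\). Two systems with the same numbers of inputs and outputs are equivalent if, from zero initial state, they produce the same output sequence for every input sequence; \(S\) is minimal if no system equivalent to \(S\) has fewer state variables. The graph \(G(S)\) is the directed graph whose vertices are the state vertices \(x_1,\dots,x_{n_x}\), the input vertices \(u_1,\dots,u_{n_u}\) and the output vertices \(y_1,\dots,y_{n_y}\), and whose edges are exactly: \((x_j,x_i)\) when \(A_{ij}\neq0\), \((u_j,x_i)\) when \(B_{ij}\neq0\), \((x_j,y_i)\) when \(C_{ij}\neq0\), and \((u_j,y_i)\) when \(D_{ij}\neq0\). A path is a sequence of vertices \(v_1v_2\cdots v_k\), \(k\ge2\), such that each \((v_l,v_{l+1})\) is an edge and no two of the vertices are equal, except possibly \(v_1\) and \(v_k\). It is a cycle if \(v_1=v_k\) (a self-loop \(vv\) is a cycle),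 and a simple path otherwise. It is \(U\)-rooted if \(v_1\) is an input vertex, and \(Y\)-topped if \(v_k\) is an output vertex. It covers the vertices \(v_1,\dots,v_k\). Two paths are disjoint if no vertex is covered by both. A path family is a set of pairwise disjoint simple paths; it is \(U\)-rooted (\(Y\)-topped) if all its members are. A cycle family is a set of pairwise disjoint cycles. The union of a path family and a cycle family is disjoint if every member of the first is disjoint from every member of the second. Families may be empty. Theorem. If \(S\) is minimal, then: 1. every state vertex \(x_i\) is the end vertex of a \(U\)-rooted path in \(G(S)\); 2. there is a disjoint union of a \(U\)-rooted path family and a cycle family in \(G(S)\) that covers all state vertices; 3. every state vertex \(x_i\) is the first vertex of a \(Y\)-topped path in \(G(S)\); 4. there is a disjoint union of a \(Y\)-topped path family and a cycle family in \(G(S)\) that covers all state vertices. -/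

import Mathlib

/-- A discrete-time LTI state-space system with `nu` inputs, `nx` state variables and `ny` outputs,
that is, a 4-tuple of real matrices `(A, B, C, D)`. -/
structure LTISystem (nu nx ny : ℕ) where
  A : Matrix (Fin nx) (Fin nx) ℝ
  B : Matrix (Fin nx) (Fin nu) ℝ
  C : Matrix (Fin ny) (Fin nx) ℝ
  D : Matrix (Fin ny) (Fin nu) ℝ

namespace LTISystem

open Matrix

variable {nu nx ny : ℕ}

/-- The state sequence `x₀ = 0`, `xₖ₊₁ = A xₖ + B uₖ` under the input sequence `u`. -/
def state (S : LTISystem nu nx ny) (u : ℕ → Fin nu → ℝ) : ℕ → Fin nx → ℝ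
  | 0 => 0
  | k + 1 => S.A *ᵥ S.state u k + S.B *ᵥ u k

/-- The output sequence `yₖ = C xₖ + D uₖ` under the input sequence `u`, from the zero initial
state. -/
def output (S : LTISystem nu nx ny) (u : ℕ → Fin nu → ℝ) (k : ℕ) : Fin ny → ℝ :=
  S.C *ᵥ S.state u k + S.D *ᵥ u k

/-- Two systems (possibly with different numbers of state variables) are equivalent if, from zero
initial conditions, every input sequence yields the same outputs at all times. -/
def Equivalent {nx' : ℕ} (S : LTISystem nu nx ny) (S' : LTISystem nu nx' ny) : Prop :=
  ∀ (u : ℕ → Fin nu → ℝ) (k : ℕ), S.output u k = S'.output u k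

/-- A system is minimal if no equivalent system has fewer state variables. -/
def IsMinimal (S : LTISystem nu nx ny) : Prop :=
  ∀ (nx' : ℕ) (S' : LTISystem nu nx' ny), S.Equivalent S' → nx ≤ nx'

/-- The vertices: state variables, followed by inputs, followed by outputs. -/
abbrev Vertex (nu nx ny : ℕ) : Type := (Fin nx ⊕ Fin nu) ⊕ Fin ny

/-- The state variable vertex `xᵢ`. -/
abbrev stateVertex (i : Fin nx) : Vertex nu nx ny := Sum.inl (Sum.inl i)

/-- The input vertex `uᵢ`. -/
abbrev inputVertex (i : Fin nu) : Vertex nu nx ny := Sum.inl (Sum.inr i)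

/-- The output vertex `yᵢ`. -/
abbrev outputVertex (i : Fin ny) : Vertex nu nx ny := Sum.inr i

/-- The square matrix with block rows `[A B 0]`, `[0 0 0]`, `[C D 0]`. -/
def systemMatrix (S : LTISystem nu nx ny) : Matrix (Vertex nu nx ny) (Vertex nu nx ny) ℝ :=
  Matrix.fromBlocks (Matrix.fromBlocks S.A S.B 0 0) 0 (Matrix.fromCols S.C S.D) 0

end LTISystem

/-- The directed graph of a square matrix: there is an edge from `v` to `w` iff `M w v ≠ 0`. -/
def matrixGraph {V : Type*} (M : Matrix V V ℝ) : Digraph V where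
  Adj v w := M w v ≠ 0

namespace LTISystem

variable {nu nx ny : ℕ}

/-- The associated graph `G(S)` of a system. -/
def graph (S : LTISystem nu nx ny) : Digraph (Vertex nu nx ny) :=
  matrixGraph S.systemMatrix

end LTISystem

namespace Digraph

variable {V : Type*}

/-- A path is a sequence of vertices `v₁ v₂ ⋯ vₖ` with `k ≥ 2`, consecutive vertices being joined by
edges, in which no two vertices coincide except possibly the first and the last. A one-vertex
sequence is not a path; in particular a single vertex without a self-loop is not a cycle. -/
structure IsPath (G : Digraph V) (p : List V) : Prop where
  two_le_length : 2 ≤ p.length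
  isChain : p.IsChain G.Adj
  eq_ends : ∀ (i j : ℕ) (hi : i < p.length) (hj : j < p.length),
    i < j → p[i] = p[j] → i = 0 ∧ j = p.length - 1

/-- A cycle is a path whose first and last vertices coincide. -/
def IsCycle (G : Digraph V) (p : List V) : Prop :=
  G.IsPath p ∧ p.head? = p.getLast?

/-- A simple path is a path whose first and last vertices differ. -/
def IsSimplePath (G : Digraph V) (p : List V) : Prop :=
  G.IsPath p ∧ p.head? ≠ p.getLast?

/-- A path family: a set of pairwise (vertex-)disjoint simple paths. -/
def IsPathFamily (G : Digraph V) (F : Set (List V)) : Prop :=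
  (∀ p ∈ F, G.IsSimplePath p) ∧ F.Pairwise List.Disjoint

/-- A cycle family: a set of pairwise (vertex-)disjoint cycles. -/
def IsCycleFamily (G : Digraph V) (F : Set (List V)) : Prop :=
  (∀ p ∈ F, G.IsCycle p) ∧ F.Pairwise List.Disjoint

end Digraph

/-- The union of the two families is disjoint. -/
def FamiliesDisjoint {V : Type*} (F₁ F₂ : Set (List V)) : Prop :=
  ∀ p ∈ F₁, ∀ q ∈ F₂, List.Disjoint p q

namespace LTISystem

variable {nu nx ny : ℕ}

/-- The first vertex of the sequence is an input vertex. -/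
def URooted (p : List (Vertex nu nx ny)) : Prop :=
  ∃ i : Fin nu, p.head? = some (inputVertex i)

/-- The last vertex of the sequence is an output vertex. -/
def YTopped (p : List (Vertex nu nx ny)) : Prop :=
  ∃ j : Fin ny, p.getLast? = some (outputVertex j)

/-- Some member of the family passes through each state variable vertex. -/
def CoversStates (F : Set (List (Vertex nu nx ny))) : Prop :=
  ∀ i : Fin nx, ∃ p ∈ F, stateVertex i ∈ p

end LTISystem

/-!
Both pairs of claims are the same claim for the system `(A, B, C, D)` and for its transpose
`(Aᵀ, Cᵀ, Bᵀ, Dᵀ)`. Transposition preserves minimality, because equivalence means equality of `D`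
and of the Markov parameters `C Aᵏ B` (`equivalent_iff_markov`), and it reverses the arrows of the
graph while exchanging inputs and outputs. So only the statements about inputs need a proof.

A minimal system is reachable: a row vector `w` with `w Aᵏ B = 0` for all `k` vanishes, since
otherwise the system could be restricted to a proper subspace that is invariant under `A` and
contains the range of `B` (`IsMinimal.eq_zero_of_vecMul_pow_mul`).

* Taking for `w` a standard basis vector, some entry `(Aᵏ B) i j` is nonzero, which provides a walk
  from `uⱼ` to `xᵢ`; shortcutting its loops gives a path.
* If `w A = 0` and `w B = 0`, then `w = 0`, so the rows of `[A B]` are linearly independent. By Hall's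
  marriage theorem there is then an injective choice of a nonzero entry in each row
  (`LinearIndependent.exists_injective_apply_ne_zero`), that is, an injective choice of a
  predecessor `f x` for each state vertex `x`. Extend `f` to a permutation of all vertices and follow
  the orbits of its inverse: an orbit inside the set of states is a cycle, and every other orbit is
  cut into simple paths, each beginning at an input (`Digraph.exists_path_cycle_cover`).
-/

open Matrix

/-! ### Hall's theorem for linearly independent rows -/

/-- Hall's condition holds for the supports of linearly independent vectors: `s` of them live in the
space of functions on the union of their supports, so that union has at least `s` elements. -/
theorem LinearIndependent.exists_injective_apply_ne_zero {K m n : Type*} [Field K] [Fintype n]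
    {M : m → n → K} (hM : LinearIndependent K M) :
    ∃ f : m → n, Function.Injective f ∧ ∀ i, M i (f i) ≠ 0 := by
  classical
  let t : m → Finset n := fun i => Finset.univ.filter fun j => M i j ≠ 0
  obtain ⟨f, hf, hft⟩ := (Finset.all_card_le_biUnion_card_iff_exists_injective t).1 (by
    intro s
    have hli : LinearIndependent K fun (i : s) (j : s.biUnion t) => M i j := by
      rw [Fintype.linearIndependent_iff]
      intro g hg
      refine Fintype.linearIndependent_iff.1
        (hM.comp (Subtype.val : s → m) Subtype.val_injective) g ?_
      ext j
      by_cases hj : j ∈ s.biUnion t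
      · simpa using congrFun hg ⟨j, hj⟩
      · simp only [t, Finset.mem_biUnion, Finset.mem_filter, Finset.mem_univ, true_and,
          not_exists, not_and, not_not] at hj
        simp only [Finset.sum_apply, Pi.smul_apply, Function.comp_apply, Pi.zero_apply]
        exact Finset.sum_eq_zero fun i _ => by rw [hj i i.2, smul_zero]
    simpa only [Module.finrank_fintype_fun_eq_card, Fintype.card_coe] using
      hli.fintype_card_le_finrank)
  exact ⟨f, hf, fun i => by simpa [t] using hft i⟩

/-! ### Paths and cycles in directed graphs -/

namespace Digraph

variable {V W : Type*} {G : Digraph V} {H : Digraph W}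

theorem isPath_of_nodup {p : List V} (h2 : 2 ≤ p.length) (hc : p.IsChain G.Adj) (hn : p.Nodup) :
    G.IsPath p where
  two_le_length := h2
  isChain := hc
  eq_ends i j hi hj hij h := by
    have := (hn.getElem_inj_iff (hi := hi) (hj := hj)).1 h
    omega

/-- A nodup walk can be prolonged by an edge to a nodup walk: if the new vertex has already been
visited, cut the walk there. -/
theorem exists_nodup_isChain_of_adj {a v w : V} (hvw : G.Adj v w)
    (h : ∃ p : List V, p.IsChain G.Adj ∧ p.Nodup ∧ p.head? = some a ∧ p.getLast? = some v) :
    ∃ p : List V, p.IsChain G.Adj ∧ p.Nodup ∧ p.head? = some a ∧ p.getLast? = some w := by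
  obtain ⟨p, hc, hn, hh, hl⟩ := h
  by_cases hw : w ∈ p
  · obtain ⟨s, t, rfl⟩ := List.append_of_mem hw
    have hpre : s ++ [w] <+: s ++ w :: t := ⟨t, by simp⟩
    refine ⟨s ++ [w], hc.prefix hpre, hn.sublist hpre.sublist, ?_, by simp⟩
    cases s <;> simpa using hh
  · refine ⟨p ++ [w], ?_, ?_, ?_, by simp⟩
    · refine List.isChain_append.2 ⟨hc, by simp, ?_⟩
      intro x hx y hy
      rw [hl] at hx
      simp only [Option.mem_def, Option.some.injEq, List.head?_cons] at hx hy
      exact hx ▸ hy ▸ hvw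
    · rw [List.nodup_append]
      exact ⟨hn, by simp, by rintro x hx y hy rfl; exact hw (List.mem_singleton.1 hy ▸ hx)⟩
    · simp [List.head?_append, hh]

/-- Reversing a path along an injective, arrow-reversing map gives a path. -/
theorem IsPath.reverse_map {φ : V → W} (hφ : Function.Injective φ)
    (hadj : ∀ v w, G.Adj v w → H.Adj (φ w) (φ v)) {p : List V} (hp : G.IsPath p) :
    H.IsPath (p.map φ).reverse where
  two_le_length := by simpa using hp.two_le_length
  isChain := by
    rw [List.isChain_reverse, List.isChain_map]
    exact hp.isChain.imp fun v w h => hadj v w h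
  eq_ends i j hi hj hij h := by
    simp only [List.length_reverse, List.length_map] at hi hj
    simp only [List.getElem_reverse, List.getElem_map, List.length_map] at h
    have := hp.eq_ends (p.length - 1 - j) (p.length - 1 - i) (by omega) (by omega) (by omega)
      (hφ h.symm)
    simp only [List.length_reverse, List.length_map]
    omega

theorem IsCycle.reverse_map {φ : V → W} (hφ : Function.Injective φ)
    (hadj : ∀ v w, G.Adj v w → H.Adj (φ w) (φ v)) {p : List V} (hp : G.IsCycle p) :
    H.IsCycle (p.map φ).reverse :=
  ⟨hp.1.reverse_map hφ hadj, by simp [hp.2]⟩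

theorem IsSimplePath.reverse_map {φ : V → W} (hφ : Function.Injective φ)
    (hadj : ∀ v w, G.Adj v w → H.Adj (φ w) (φ v)) {p : List V} (hp : G.IsSimplePath p) :
    H.IsSimplePath (p.map φ).reverse := by
  refine ⟨hp.1.reverse_map hφ hadj, fun h => hp.2 ?_⟩
  rw [List.head?_reverse, List.getLast?_reverse, List.head?_map, List.getLast?_map] at h
  exact (Option.map_injective hφ h).symm

theorem disjoint_reverse_map {φ : V → W} (hφ : Function.Injective φ) {p q : List V}
    (h : p.Disjoint q) : (p.map φ).reverse.Disjoint (q.map φ).reverse := by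
  intro w hp hq
  simp only [List.mem_reverse, List.mem_map] at hp hq
  obtain ⟨a, ha, rfl⟩ := hp
  obtain ⟨b, hb, hab⟩ := hq
  exact h ha (hφ hab ▸ hb)

theorem pairwise_disjoint_reverse_map {φ : V → W} (hφ : Function.Injective φ) {F : Set (List V)}
    (h : F.Pairwise List.Disjoint) :
    ((fun p => (p.map φ).reverse) '' F).Pairwise List.Disjoint := by
  rintro _ ⟨p, hp, rfl⟩ _ ⟨q, hq, rfl⟩ hne
  exact disjoint_reverse_map hφ (h hp hq fun e => hne (by rw [e]))

/-! ### Orbits of a permutation as paths and cycles -/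

/-- The orbit segment `v, τ v, …, τᵐ v`. -/
def orbitList (τ : Equiv.Perm V) (v : V) (m : ℕ) : List V :=
  (List.range (m + 1)).map fun k => (τ ^ k) v

theorem mem_orbitList {τ : Equiv.Perm V} {v w : V} {m : ℕ} :
    w ∈ orbitList τ v m ↔ ∃ k ≤ m, (τ ^ k) v = w := by
  simp [orbitList]

theorem length_orbitList (τ : Equiv.Perm V) (v : V) (m : ℕ) :
    (orbitList τ v m).length = m + 1 := by
  simp [orbitList]

theorem head?_orbitList (τ : Equiv.Perm V) (v : V) (m : ℕ) :
    (orbitList τ v m).head? = some v := by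
  simp [orbitList, List.head?_range]

theorem getLast?_orbitList (τ : Equiv.Perm V) (v : V) (m : ℕ) :
    (orbitList τ v m).getLast? = some ((τ ^ m) v) := by
  simp [orbitList, List.range_succ]

theorem isChain_orbitList {τ : Equiv.Perm V} {v : V} {m : ℕ}
    (h : ∀ k < m, G.Adj ((τ ^ k) v) ((τ ^ (k + 1)) v)) :
    (orbitList τ v m).IsChain G.Adj := by
  rw [List.isChain_iff_getElem]
  intro i hi
  rw [length_orbitList] at hi
  simpa [orbitList] using h i (by omega)

theorem pow_sub_apply_of_pow_apply_eq {τ : Equiv.Perm V} {v w : V} {i j : ℕ} (hij : i ≤ j)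
    (h : (τ ^ i) v = (τ ^ j) w) : v = (τ ^ (j - i)) w := by
  apply (τ ^ i).injective
  rw [h, ← Equiv.Perm.mul_apply, ← pow_add, Nat.add_sub_cancel' hij]

/-- Two orbit segments that begin outside `X` and otherwise stay in `X` are disjoint unless they
begin at the same vertex. -/
theorem disjoint_orbitList {τ : Equiv.Perm V} {X : Set V} {v w : V} {m n : ℕ} (hv : v ∉ X)
    (hw : w ∉ X) (hvm : ∀ k, 1 ≤ k → k ≤ m → (τ ^ k) v ∈ X)
    (hwn : ∀ k, 1 ≤ k → k ≤ n → (τ ^ k) w ∈ X) (hvw : v ≠ w) :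
    (orbitList τ v m).Disjoint (orbitList τ w n) := by
  intro x hx hy
  obtain ⟨i, hi, rfl⟩ := mem_orbitList.1 hx
  obtain ⟨j, hj, hij⟩ := mem_orbitList.1 hy
  rcases lt_trichotomy i j with h | rfl | h
  · exact hv (pow_sub_apply_of_pow_apply_eq h.le hij.symm ▸ hwn (j - i) (by omega) (by omega))
  · exact hvw ((τ ^ i).injective hij.symm)
  · exact hw (pow_sub_apply_of_pow_apply_eq h.le hij ▸ hvm (i - j) (by omega) (by omega))

/-- If every vertex `x` of `X` has been assigned a predecessor `f x`, injectively, then `X` is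
covered by disjoint cycles and simple paths, the latter beginning outside `X` at assigned
predecessors. -/
theorem exists_path_cycle_cover [Finite V] (X : Set V) (f : V → V) (hf : Set.InjOn f X)
    (hadj : ∀ x ∈ X, G.Adj (f x) x) :
    ∃ F₁ F₂ : Set (List V), G.IsPathFamily F₁ ∧
      (∀ p ∈ F₁, ∃ x ∈ X, f x ∉ X ∧ p.head? = some (f x)) ∧
      G.IsCycleFamily F₂ ∧ FamiliesDisjoint F₁ F₂ ∧ ∀ x ∈ X, ∃ p ∈ F₁ ∪ F₂, x ∈ p := by
  classical
  have := Fintype.ofFinite V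
  let σ : Equiv.Perm V :=
    (Equiv.Set.imageOfInjOn f X hf : {x // x ∈ X} ≃ {x // x ∈ f '' X}).extendSubtype
  have hσ : ∀ x ∈ X, σ x = f x := fun x hx =>
    Equiv.extendSubtype_apply_of_mem
      (Equiv.Set.imageOfInjOn f X hf : {x // x ∈ X} ≃ {x // x ∈ f '' X}) x hx
  -- `τ` sends a chosen predecessor back to its vertex, so its orbits follow the edges.
  let τ : Equiv.Perm V := σ⁻¹
  have hfτ : ∀ v, τ v ∈ X → f (τ v) = v := fun v hv => by
    rw [← hσ _ hv]; exact σ.apply_symm_apply v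
  have hstep : ∀ v, τ v ∈ X → G.Adj v (τ v) := fun v hv => by
    have := hadj _ hv
    rwa [hfτ v hv] at this
  have hsucc : ∀ (k : ℕ) (v : V), (τ ^ (k + 1)) v = τ ((τ ^ k) v) := fun k v => by
    rw [pow_succ', Equiv.Perm.mul_apply]
  have hedge : ∀ (k : ℕ) (v : V), (τ ^ (k + 1)) v ∈ X → G.Adj ((τ ^ k) v) ((τ ^ (k + 1)) v) := by
    intro k v h
    rw [hsucc] at h ⊢
    exact hstep _ h
  have hper : ∀ v : V, ∃ n, 0 < n ∧ (τ ^ n) v = v := fun v =>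
    ⟨orderOf τ, orderOf_pos τ, by simp [pow_orderOf_eq_one]⟩
  have hback : ∀ (i : ℕ) (v : V), ∃ j : ℕ, (τ ^ j) ((τ ^ i) v) = v := fun i v => by
    obtain ⟨N, hN, hNv⟩ := hper v
    refine ⟨N * i - i, ?_⟩
    rw [← Equiv.Perm.mul_apply, ← pow_add, Nat.sub_add_cancel (Nat.le_mul_of_pos_left i hN),
      pow_mul, Equiv.Perm.pow_apply_eq_self_of_apply_eq_self hNv]
  -- The paths are cut just before the orbit leaves `X`.
  let F₁ : Set (List V) := {p | ∃ (v : V) (m : ℕ), v ∉ X ∧ 1 ≤ m ∧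
    (∀ k, 1 ≤ k → k ≤ m → (τ ^ k) v ∈ X) ∧ (τ ^ (m + 1)) v ∉ X ∧ p = orbitList τ v m}
  -- One cycle for each orbit contained in `X`, written from a representative of the orbit.
  let F₂ : Set (List V) := {p | ∃ (v : V) (m : ℕ), (∀ k : ℕ, (τ ^ k) v ∈ X) ∧
    (Quotient.mk (Equiv.Perm.SameCycle.setoid τ) v).out = v ∧ 0 < m ∧ (τ ^ m) v = v ∧
    (∀ k, 0 < k → k < m → (τ ^ k) v ≠ v) ∧ p = orbitList τ v m}
  refine ⟨F₁, F₂, ⟨?_, ?_⟩, ?_, ⟨?_, ?_⟩, ?_, ?_⟩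
  · rintro _ ⟨v, m, hv, hm, hk, -, rfl⟩
    have hne : ∀ i j, i < j → j ≤ m → (τ ^ i) v ≠ (τ ^ j) v := fun i j hij hj h =>
      hv (pow_sub_apply_of_pow_apply_eq hij.le h ▸ hk (j - i) (by omega) (by omega))
    refine ⟨⟨by rw [length_orbitList]; omega,
      isChain_orbitList fun k hkm => hedge k v (hk (k + 1) (by omega) (by omega)), ?_⟩, ?_⟩
    · intro i j hi hj hij h
      rw [length_orbitList] at hi hj
      exact absurd (by simpa [orbitList] using h) (hne i j hij (by omega))
    · rw [head?_orbitList, getLast?_orbitList]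
      intro h
      exact hne 0 m (by omega) le_rfl (by simpa using h)
  · rintro _ ⟨v, m, hv, hm, hk, hm', rfl⟩ _ ⟨w, n, hw, hn, hk', hn', rfl⟩ hne
    refine disjoint_orbitList hv hw hk hk' ?_
    rintro rfl
    -- The stopping time is determined by the initial vertex.
    rcases lt_trichotomy m n with h | rfl | h
    · exact hm' (hk' (m + 1) (by omega) (by omega))
    · exact hne rfl
    · exact hn' (hk (n + 1) (by omega) (by omega))
  · rintro _ ⟨v, m, hv, hm, hk, -, rfl⟩
    have h1 : τ v ∈ X := by simpa using hk 1 le_rfl hm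
    exact ⟨τ v, h1, by rwa [hfτ v h1], by rw [hfτ v h1, head?_orbitList]⟩
  · rintro _ ⟨v, m, hX, -, hm, hmv, hmin, rfl⟩
    refine ⟨⟨by rw [length_orbitList]; omega,
      isChain_orbitList fun k _ => hedge k v (hX (k + 1)), ?_⟩, ?_⟩
    · intro i j hi hj hij h
      rw [length_orbitList] at hi hj ⊢
      have h' : (τ ^ i) v = (τ ^ j) v := by simpa [orbitList] using h
      have := pow_sub_apply_of_pow_apply_eq hij.le h'
      by_contra hcon
      exact hmin (j - i) (by omega) (by omega) this.symm
    · rw [head?_orbitList, getLast?_orbitList, hmv]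
  · rintro _ ⟨v, m, -, hv, hm, hmv, hmin, rfl⟩ _ ⟨w, n, -, hw, hn, hnw, hmin', rfl⟩ hne x hx hy
    obtain ⟨i, -, rfl⟩ := mem_orbitList.1 hx
    obtain ⟨j, -, hij⟩ := mem_orbitList.1 hy
    have hsame : Equiv.Perm.SameCycle τ v w := by
      rw [← Equiv.Perm.sameCycle_pow_left (n := i), ← hij, Equiv.Perm.sameCycle_pow_left]
    obtain rfl : v = w := by
      rw [← hv, ← hw]
      exact congrArg _ (Quotient.sound hsame)
    rcases lt_trichotomy m n with h | rfl | h
    · exact hmin' m hm h hmv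
    · exact hne rfl
    · exact hmin n hn h hnw
  · rintro _ ⟨v, m, hv, hm, hk, -, rfl⟩ _ ⟨w, n, hX, -, -, -, -, rfl⟩ x hx hy
    obtain ⟨i, -, rfl⟩ := mem_orbitList.1 hx
    obtain ⟨j, -, hij⟩ := mem_orbitList.1 hy
    obtain ⟨k, hk⟩ := hback i v
    refine hv ?_
    rw [← hk, ← hij, ← Equiv.Perm.mul_apply, ← pow_add]
    exact hX _
  · intro x hx
    by_cases hX : ∀ k : ℕ, (τ ^ k) x ∈ X
    · let v := (Quotient.mk (Equiv.Perm.SameCycle.setoid τ) x).out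
      have hvq : Quotient.mk (Equiv.Perm.SameCycle.setoid τ) v = Quotient.mk _ x :=
        Quotient.out_eq _
      have hvx : Equiv.Perm.SameCycle τ v x := Quotient.exact hvq
      obtain ⟨a, -, ha⟩ := hvx.symm.exists_pow_eq'
      obtain ⟨b, -, hb⟩ := hvx.exists_pow_eq'
      have hm := hper v
      have hmod : ∃ k < Nat.find hm, (τ ^ k) v = x := by
        refine ⟨b % Nat.find hm, Nat.mod_lt _ (Nat.find_spec hm).1, ?_⟩
        rw [← hb]
        conv_rhs => rw [← Nat.mod_add_div b (Nat.find hm), pow_add, pow_mul,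
          Equiv.Perm.mul_apply,
          Equiv.Perm.pow_apply_eq_self_of_apply_eq_self (Nat.find_spec hm).2]
      obtain ⟨k, hk, hkx⟩ := hmod
      refine ⟨orbitList τ v (Nat.find hm), Or.inr ⟨v, Nat.find hm, fun k => ?_, ?_,
        (Nat.find_spec hm).1, (Nat.find_spec hm).2, fun k hk hkm h => ?_, rfl⟩,
        mem_orbitList.2 ⟨k, hk.le, hkx⟩⟩
      · rw [← ha, ← Equiv.Perm.mul_apply, ← pow_add]
        exact hX _
      · rw [hvq]
      · exact Nat.find_min hm hkm ⟨hk, h⟩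
    · push Not at hX
      -- The path starts at the last vertex outside `X` met before `x`, at distance `j`.
      have hpre : ∃ (j : ℕ) (v : V), v ∉ X ∧ (τ ^ j) v = x := by
        obtain ⟨k, hk⟩ := hX
        obtain ⟨j, hj⟩ := hback k x
        exact ⟨j, _, hk, hj⟩
      obtain ⟨v, hv, hvx⟩ := Nat.find_spec hpre
      set j := Nat.find hpre
      have hin : ∀ i, 1 ≤ i → i ≤ j → (τ ^ i) v ∈ X := by
        intro i hi hij
        by_contra hcon
        refine Nat.find_min hpre (m := j - i) (by omega) ⟨_, hcon, ?_⟩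
        rw [← Equiv.Perm.mul_apply, ← pow_add, Nat.sub_add_cancel hij, hvx]
      have hj0 : j ≠ 0 := fun h0 => by
        rw [h0] at hvx
        exact hv (by simpa [← hvx] using hx)
      have hexit : ∃ m : ℕ, (τ ^ (m + 1)) v ∉ X := by
        obtain ⟨N, hN, hNv⟩ := hper v
        exact ⟨N - 1, by rwa [Nat.sub_add_cancel hN, hNv]⟩
      have hjm : j ≤ Nat.find hexit := by
        by_contra hcon
        exact Nat.find_spec hexit (hin _ (by omega) (by omega))
      refine ⟨orbitList τ v (Nat.find hexit), Or.inl ⟨v, Nat.find hexit, hv, by omega,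
        fun k hk hkm => ?_, Nat.find_spec hexit, rfl⟩, mem_orbitList.2 ⟨j, hjm, hvx⟩⟩
      by_contra hcon
      exact Nat.find_min hexit (m := k - 1) (by omega) (by rwa [Nat.sub_add_cancel hk])

end Digraph

/-! ### Markov parameters and transposition -/

namespace LTISystem

variable {nu nx ny nx' : ℕ}

/-- The state is the convolution of the input with the sequence `Aᵏ B`. -/
theorem state_eq_sum (S : LTISystem nu nx ny) (u : ℕ → Fin nu → ℝ) (k : ℕ) :
    S.state u k = ∑ j ∈ Finset.range k, (S.A ^ (k - 1 - j) * S.B) *ᵥ u j := by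
  induction k with
  | zero => simp [state]
  | succ k ih =>
    rw [state, ih, Finset.sum_range_succ, mulVec_sum]
    congr 1
    · refine Finset.sum_congr rfl fun j hj => ?_
      have hj := Finset.mem_range.1 hj
      rw [mulVec_mulVec, ← Matrix.mul_assoc, ← pow_succ']
      congr 4
      omega
    · simp

theorem equivalent_iff_markov {S : LTISystem nu nx ny} {T : LTISystem nu nx' ny} :
    S.Equivalent T ↔ S.D = T.D ∧ ∀ k, S.C * S.A ^ k * S.B = T.C * T.A ^ k * T.B := by
  constructor
  · intro h
    have hD : S.D = T.D := by
      refine Matrix.ext_of_mulVec_single fun i => ?_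
      simpa [output, state] using h (fun _ => Pi.single i 1) 0
    refine ⟨hD, fun k => Matrix.ext_of_mulVec_single fun i => ?_⟩
    -- Markov parameters are responses to an impulse at time `0`.
    have := h (fun j => if j = 0 then Pi.single i 1 else 0) (k + 1)
    simpa only [output, state_eq_sum, Finset.sum_range_succ', Nat.add_eq_zero_iff, one_ne_zero,
      and_false, if_false, if_true, mulVec_zero, Finset.sum_const_zero, zero_add, add_zero,
      Nat.add_sub_cancel, Nat.sub_zero, mulVec_mulVec, ← Matrix.mul_assoc] using this
  · rintro ⟨hD, hM⟩ u k
    simp only [output, state_eq_sum, mulVec_sum, mulVec_mulVec, ← Matrix.mul_assoc, hD, hM]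

/-- The transposed (dual) system. -/
def dual (S : LTISystem nu nx ny) : LTISystem ny nx nu where
  A := S.Aᵀ
  B := S.Cᵀ
  C := S.Bᵀ
  D := S.Dᵀ

theorem IsMinimal.dual {S : LTISystem nu nx ny} (hS : S.IsMinimal) : S.dual.IsMinimal := by
  intro n T hT
  refine hS n T.dual ?_
  rw [equivalent_iff_markov] at hT ⊢
  refine ⟨by simpa [LTISystem.dual] using congrArg transpose hT.1, fun k => ?_⟩
  simpa [LTISystem.dual, transpose_mul, transpose_pow, Matrix.mul_assoc] using
    congrArg transpose (hT.2 k)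

/-! ### Minimal systems are reachable -/

/-- If `P` intertwines the dynamics of `S` with those of a system with `r` states, then `C P` is an
output matrix that makes the two systems equivalent. -/
theorem IsMinimal.le_of_intertwining {S : LTISystem nu nx ny} (hS : S.IsMinimal) {r : ℕ}
    {P : Matrix (Fin nx) (Fin r) ℝ} {A' : Matrix (Fin r) (Fin r) ℝ} {B' : Matrix (Fin r) (Fin nu) ℝ}
    (hA : S.A * P = P * A') (hB : S.B = P * B') : nx ≤ r := by
  refine hS r ⟨A', B', S.C * P, S.D⟩ ?_
  have hpow : ∀ k : ℕ, S.A ^ k * P = P * A' ^ k := by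
    intro k
    induction k with
    | zero => simp
    | succ k ih =>
      rw [pow_succ', Matrix.mul_assoc, ih, ← Matrix.mul_assoc, hA, Matrix.mul_assoc,
        ← pow_succ']
  refine equivalent_iff_markov.2 ⟨rfl, fun k => ?_⟩
  change S.C * S.A ^ k * S.B = S.C * P * A' ^ k * B'
  rw [hB, Matrix.mul_assoc S.C P, ← hpow, ← Matrix.mul_assoc, ← Matrix.mul_assoc]

theorem IsMinimal.le_finrank {S : LTISystem nu nx ny} (hS : S.IsMinimal)
    (R : Submodule ℝ (Fin nx → ℝ)) (hA : ∀ x ∈ R, S.A *ᵥ x ∈ R) (hB : ∀ u, S.B *ᵥ u ∈ R) :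
    nx ≤ Module.finrank ℝ R := by
  let e := (Module.finBasis ℝ R).equivFun
  let P : (Fin (Module.finrank ℝ R) → ℝ) →ₗ[ℝ] (Fin nx → ℝ) := R.subtype ∘ₗ e.symm.toLinearMap
  let a := e.toLinearMap ∘ₗ (S.A.mulVecLin.restrict hA) ∘ₗ e.symm.toLinearMap
  let b := e.toLinearMap ∘ₗ (S.B.mulVecLin.codRestrict R hB)
  refine hS.le_of_intertwining (P := LinearMap.toMatrix' P) (A' := LinearMap.toMatrix' a)
    (B' := LinearMap.toMatrix' b) ?_ ?_
  · rw [← LinearMap.toMatrix'_comp, ← LinearMap.toMatrix'_toLin' S.A,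
      ← LinearMap.toMatrix'_comp]
    congr 1
    refine LinearMap.ext fun x => ?_
    simp [P, a]
    rfl
  · rw [← LinearMap.toMatrix'_comp, ← LinearMap.toMatrix'_toLin' S.B]
    congr 1
    refine LinearMap.ext fun x => ?_
    simp [P, b]
    rfl

/-- Reachability of a minimal system: the subspace orthogonal to all `w` with `w Aᵏ B = 0` contains
the range of `B` and is invariant under `A`, so it is the whole space. -/
theorem IsMinimal.eq_zero_of_vecMul_pow_mul {S : LTISystem nu nx ny} (hS : S.IsMinimal)
    {w : Fin nx → ℝ} (hw : ∀ k : ℕ, w ᵥ* (S.A ^ k * S.B) = 0) : w = 0 := by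
  let R : Submodule ℝ (Fin nx → ℝ) :=
    { carrier := {x | ∀ z : Fin nx → ℝ, (∀ k : ℕ, z ᵥ* (S.A ^ k * S.B) = 0) → z ⬝ᵥ x = 0}
      zero_mem' := fun z _ => dotProduct_zero z
      add_mem' := fun hx hy z hz => by rw [dotProduct_add, hx z hz, hy z hz, add_zero]
      smul_mem' := fun c x hx z hz => by rw [dotProduct_smul, hx z hz, smul_zero] }
  have hle : nx ≤ Module.finrank ℝ R := by
    refine hS.le_finrank R (fun x hx z hz => ?_) (fun u z hz => ?_)
    · rw [dotProduct_mulVec]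
      refine hx _ fun k => ?_
      rw [vecMul_vecMul, ← Matrix.mul_assoc, ← pow_succ']
      exact hz (k + 1)
    · have h0 := hz 0
      rw [pow_zero, Matrix.one_mul] at h0
      rw [dotProduct_mulVec, h0, zero_dotProduct]
  have htop : R = ⊤ := by
    refine Submodule.eq_top_of_finrank_eq (le_antisymm (Submodule.finrank_le R) ?_)
    simpa using hle
  have hmem : w ∈ R := htop ▸ Submodule.mem_top
  exact dotProduct_self_eq_zero.1 (hmem w hw)

theorem IsMinimal.linearIndependent_fromCols {S : LTISystem nu nx ny} (hS : S.IsMinimal) :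
    LinearIndependent ℝ (fromCols S.A S.B).row := by
  rw [← vecMul_injective_iff]
  refine (injective_iff_map_eq_zero (vecMulLinear (fromCols S.A S.B))).2 fun w hw => ?_
  rw [vecMulLinear_apply, vecMul_fromCols] at hw
  have hA : w ᵥ* S.A = 0 := funext fun i => congrFun hw (Sum.inl i)
  have hB : w ᵥ* S.B = 0 := funext fun i => congrFun hw (Sum.inr i)
  refine hS.eq_zero_of_vecMul_pow_mul fun k => ?_
  cases k with
  | zero => rw [pow_zero, Matrix.one_mul, hB]
  | succ k => rw [pow_succ', ← vecMul_vecMul, ← vecMul_vecMul, hA, zero_vecMul, zero_vecMul]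

/-! ### The graph of a minimal system -/

/-- If `(Aᵏ B) i j ≠ 0`, then there is a walk from `uⱼ` to `xᵢ` of length `k + 1`; the
conclusion retains a walk without repeated vertices obtained by shortcutting it. -/
theorem exists_nodup_isChain_of_pow_mul_ne_zero (S : LTISystem nu nx ny) (j : Fin nu) (k : ℕ)
    (i : Fin nx) (h : (S.A ^ k * S.B) i j ≠ 0) :
    ∃ p : List (Vertex nu nx ny), p.IsChain S.graph.Adj ∧ p.Nodup ∧
      p.head? = some (inputVertex j) ∧ p.getLast? = some (stateVertex i) := by
  induction k generalizing i with
  | zero =>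
    refine Digraph.exists_nodup_isChain_of_adj (v := inputVertex j) ?_
      ⟨[inputVertex j], by simp⟩
    simpa [graph, matrixGraph, systemMatrix] using h
  | succ k ih =>
    rw [pow_succ', Matrix.mul_assoc, mul_apply] at h
    obtain ⟨l, -, hl⟩ := Finset.exists_ne_zero_of_sum_ne_zero h
    refine Digraph.exists_nodup_isChain_of_adj ?_ (ih l (right_ne_zero_of_mul hl))
    simpa [graph, matrixGraph, systemMatrix] using left_ne_zero_of_mul hl

theorem IsMinimal.exists_uRooted_path {S : LTISystem nu nx ny} (hS : S.IsMinimal) (i : Fin nx) :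
    ∃ p : List (Vertex nu nx ny), S.graph.IsPath p ∧ URooted p ∧
      p.getLast? = some (stateVertex i) := by
  obtain ⟨k, j, hkj⟩ : ∃ (k : ℕ) (j : Fin nu), (S.A ^ k * S.B) i j ≠ 0 := by
    by_contra! hcon
    have := hS.eq_zero_of_vecMul_pow_mul (w := Pi.single i 1) fun k => by
      ext j
      simpa using hcon k j
    simpa using congrFun this i
  obtain ⟨p, hc, hn, hh, hl⟩ := S.exists_nodup_isChain_of_pow_mul_ne_zero j k i hkj
  refine ⟨p, Digraph.isPath_of_nodup ?_ hc hn, ⟨j, hh⟩, hl⟩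
  match p, hh, hl with
  | [v], hh, hl => simp_all
  | _ :: _ :: _, _, _ => simp

theorem IsMinimal.exists_uRooted_cover {S : LTISystem nu nx ny} (hS : S.IsMinimal) :
    ∃ F₁ F₂ : Set (List (Vertex nu nx ny)),
      S.graph.IsPathFamily F₁ ∧ (∀ p ∈ F₁, URooted p) ∧
        S.graph.IsCycleFamily F₂ ∧ FamiliesDisjoint F₁ F₂ ∧ CoversStates (F₁ ∪ F₂) := by
  obtain ⟨f, hf, hne⟩ := hS.linearIndependent_fromCols.exists_injective_apply_ne_zero
  -- Only the values of `g` at state vertices matter.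
  let g : Vertex nu nx ny → Vertex nu nx ny :=
    Sum.elim (Sum.elim (fun i => Sum.inl (f i)) (fun j => inputVertex j)) (fun j => outputVertex j)
  obtain ⟨F₁, F₂, h₁, hroot, h₂, hd, hc⟩ := Digraph.exists_path_cycle_cover (G := S.graph)
    (Set.range stateVertex) g
    (by
      rintro _ ⟨i, rfl⟩ _ ⟨j, rfl⟩ h
      rw [hf (Sum.inl_injective h)])
    (by
      rintro _ ⟨i, rfl⟩
      have := hne i
      change S.systemMatrix (Sum.inl (Sum.inl i)) (Sum.inl (f i)) ≠ 0
      rcases hfi : f i with l | l <;> simpa [systemMatrix, hfi] using this)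
  refine ⟨F₁, F₂, h₁, fun p hp => ?_, h₂, hd, fun i => hc _ ⟨i, rfl⟩⟩
  obtain ⟨_, ⟨i, rfl⟩, hout, hhead⟩ := hroot p hp
  have hg : g (stateVertex i) = Sum.inl (f i) := rfl
  rw [hg] at hout hhead
  rcases hfi : f i with l | l
  · exact absurd ⟨l, by rw [hfi]⟩ hout
  · exact ⟨l, by rw [hhead, hfi]⟩

/-! ### Duality of the graphs -/

/-- The identification of the vertices of the dual system: states are kept, inputs and outputs are
exchanged. -/
def dualVertex : Vertex ny nx nu → Vertex nu nx ny
  | Sum.inl (Sum.inl i) => stateVertex i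
  | Sum.inl (Sum.inr j) => outputVertex j
  | Sum.inr j => inputVertex j

theorem dualVertex_injective :
    Function.Injective (dualVertex : Vertex ny nx nu → Vertex nu nx ny) := by
  rintro ((i | i) | i) ((j | j) | j) h <;> simp_all [dualVertex]

theorem graph_adj_dualVertex (S : LTISystem nu nx ny) (v w : Vertex ny nx nu)
    (h : S.dual.graph.Adj v w) : S.graph.Adj (dualVertex w) (dualVertex v) := by
  rcases v with (i | i) | i <;> rcases w with (j | j) | j <;>
    simp_all [graph, matrixGraph, systemMatrix, dual, dualVertex]

theorem URooted.yTopped_dual {p : List (Vertex ny nx nu)} (h : URooted p) :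
    YTopped (p.map dualVertex).reverse := by
  obtain ⟨j, hj⟩ := h
  exact ⟨j, by simp [hj, dualVertex]⟩

theorem IsMinimal.exists_yTopped_path {S : LTISystem nu nx ny} (hS : S.IsMinimal) (i : Fin nx) :
    ∃ p : List (Vertex nu nx ny), S.graph.IsPath p ∧ YTopped p ∧
      p.head? = some (stateVertex i) := by
  obtain ⟨p, hp, hr, hl⟩ := hS.dual.exists_uRooted_path i
  exact ⟨_, hp.reverse_map dualVertex_injective S.graph_adj_dualVertex, hr.yTopped_dual,
    by simp [hl, dualVertex]⟩

theorem IsMinimal.exists_yTopped_cover {S : LTISystem nu nx ny} (hS : S.IsMinimal) :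
    ∃ F₁ F₂ : Set (List (Vertex nu nx ny)),
      S.graph.IsPathFamily F₁ ∧ (∀ p ∈ F₁, YTopped p) ∧
        S.graph.IsCycleFamily F₂ ∧ FamiliesDisjoint F₁ F₂ ∧ CoversStates (F₁ ∪ F₂) := by
  obtain ⟨F₁, F₂, h₁, hr, h₂, hd, hc⟩ := hS.dual.exists_uRooted_cover
  refine ⟨(fun p => (p.map dualVertex).reverse) '' F₁,
    (fun p => (p.map dualVertex).reverse) '' F₂,
    ⟨?_, Digraph.pairwise_disjoint_reverse_map dualVertex_injective h₁.2⟩, ?_,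
    ⟨?_, Digraph.pairwise_disjoint_reverse_map dualVertex_injective h₂.2⟩, ?_, ?_⟩
  · rintro _ ⟨p, hp, rfl⟩
    exact (h₁.1 p hp).reverse_map dualVertex_injective S.graph_adj_dualVertex
  · rintro _ ⟨p, hp, rfl⟩
    exact (hr p hp).yTopped_dual
  · rintro _ ⟨p, hp, rfl⟩
    exact (h₂.1 p hp).reverse_map dualVertex_injective S.graph_adj_dualVertex
  · rintro _ ⟨p, hp, rfl⟩ _ ⟨q, hq, rfl⟩
    exact Digraph.disjoint_reverse_map dualVertex_injective (hd p hp q hq)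
  · intro i
    obtain ⟨p, hp, hi⟩ := hc i
    rw [← Set.image_union]
    exact ⟨_, ⟨p, hp, rfl⟩, List.mem_reverse.2 (List.mem_map.2 ⟨_, hi, rfl⟩)⟩

end LTISystem

theorem mainTheorem2 {nu nx ny : ℕ} (S : LTISystem nu nx ny) (hS : S.IsMinimal) :
    (∀ i : Fin nx, ∃ p : List (LTISystem.Vertex nu nx ny),
      S.graph.IsPath p ∧ LTISystem.URooted p ∧
        p.getLast? = some (LTISystem.stateVertex i)) ∧
    (∃ F₁ F₂ : Set (List (LTISystem.Vertex nu nx ny)),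
      S.graph.IsPathFamily F₁ ∧ (∀ p ∈ F₁, LTISystem.URooted p) ∧
        S.graph.IsCycleFamily F₂ ∧ FamiliesDisjoint F₁ F₂ ∧
        LTISystem.CoversStates (F₁ ∪ F₂)) ∧
    (∀ i : Fin nx, ∃ p : List (LTISystem.Vertex nu nx ny),
      S.graph.IsPath p ∧ LTISystem.YTopped p ∧
        p.head? = some (LTISystem.stateVertex i)) ∧
    (∃ F₁ F₂ : Set (List (LTISystem.Vertex nu nx ny)),
      S.graph.IsPathFamily F₁ ∧ (∀ p ∈ F₁, LTISystem.YTopped p) ∧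
        S.graph.IsCycleFamily F₂ ∧ FamiliesDisjoint F₁ F₂ ∧
        LTISystem.CoversStates (F₁ ∪ F₂)) :=
  ⟨hS.exists_uRooted_path, hS.exists_uRooted_cover, hS.exists_yTopped_path,
    hS.exists_yTopped_cover⟩
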